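/- Let $\Theta\subseteq\mathbb R^p$ ($p\in\mathbb N$) and let $\{f_\theta:\theta\in\Theta\}$ be a family of probability densities on $\mathbb R$ with respect to Lebesgue measure, with $(\theta,x)\mapsto f_\theta(x)$ Borel measurable; write $F_\theta(\mathrm dx)=f_\theta(x)\,\mathrm dx$. Let $d_h(f,g)=\big[\int_{\mathbb R}(\sqrt{f}-\sqrt{g})^2\,\mathrm dx\big]^{1/2}$ be the Hellinger distance, and assume that for all $\theta,\theta_1,\theta_2,\ldots\in\Theta$ $$\lim_{k\to\infty}\|\theta_k-\theta\|=0\iff\lim_{k\to\infty}d_h(f_{\theta_k},f_\theta)=0 .$$ Let $\Pi$ be a probability measure (the prior) on $(\Theta,\mathscr B(\Theta))$, and for data $X_{1:n}=(X_1,\dots,X_n)$ let $$\Pi(\mathrm d\theta\mid X_{1:n})=\frac{\prod_{i=1}^n f_\theta(X_i)\,\Pi(\mathrm d\theta)}{\int_\Theta\prod_{i=1}^n f_{\theta'}(X_i)\,\Pi(\mathrm d\theta')},\qquad \hat f_n=\int_\Theta f_\theta\,\Pi(\mathrm d\theta\mid X_{1:n})$$ be the posterior and the posterior predictive density. Let $\theta_\star\in\Theta$,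 and let $X_1,X_2,\ldots$ be i.i.d. from $F_{\theta_\star}$, with joint law $F_{\theta_\star}^\infty$. Suppose that (i) $\theta_\star$ lies in the Kullback–Leibler support of $\Pi$: $\Pi(\{\theta\in\Theta:\mathrm{KL}(f_{\theta_\star},f_\theta)<\varepsilon\})>0$ for all $\varepsilon>0$, where $\mathrm{KL}(f,g)=\int_{\mathbb R} f\ln(f/g)\,\mathrm dx\in[0,\infty]$; (ii) the family is sequentially identifiable at $\theta_\star$: for every sequence $(\theta_j)$ in $\Theta$, if $F_{\theta_j}\to F_{\theta_\star}$ weakly, then $\|\theta_j-\theta_\star\|\to0$. Then, $F_{\theta_\star}^\infty$-almost surely, for every $n$ the posterior is a well-defined probability measure and the integral defining $\hat f_n(y)$ converges for Lebesgue-almost every $y$. The posterior is consistent at $\theta_\star$: for every $\varepsilon>0$, $F_{\theta_\star}^\infty$-almost surely, $$\lim_{n\to\infty}\Pi(\{\theta\in\Theta:\|\theta-\theta_\star\|\ge\varepsilon\}\mid X_{1:n})=0\quad\text{and}\quad\lim_{n\to\infty}\Pi(\{\theta\in\Theta:d_h(f_\theta,f_{\theta_\star})\ge\varepsilon\}\mid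 X_{1:n})=0 .$$ Moreover $\hat f_n$ is a Hellinger-consistent estimator of $f_{\theta_\star}$: $F_{\theta_\star}^\infty$-almost surely, $\lim_{n\to\infty}d_h(\hat f_n,f_{\theta_\star})=0$. -/

import Mathlib

open MeasureTheory ProbabilityTheory Filter Topology

noncomputable section

/-- A parametric family `{f_θ : θ ∈ Θ}` of probability densities on the real line with respect to
Lebesgue measure, with parameter set `Θ ⊆ ℝ^p`. Joint measurability is what makes the integrals over
`Θ` in Bayes' rule meaningful. -/
structure DensityFamily {p : ℕ} (Θ : Set (EuclideanSpace ℝ (Fin p))) where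
  /-- The density `f_θ`. -/
  density : Θ → ℝ → ℝ
  measurable_density : Measurable (Function.uncurry density)
  density_nonneg : ∀ θ x, 0 ≤ density θ x
  lintegral_density : ∀ θ, ∫⁻ x, ENNReal.ofReal (density θ x) = 1

/-- The Hellinger distance `(∫ (√f - √g)² dx)^{1/2}`, computed in `[0, ∞]`. -/
def hellingerDist (f g : ℝ → ℝ) : ENNReal :=
  (∫⁻ x, ENNReal.ofReal ((Real.sqrt (f x) - Real.sqrt (g x)) ^ 2)) ^ (1 / 2 : ℝ)

namespace DensityFamily

variable {p : ℕ} {Θ : Set (EuclideanSpace ℝ (Fin p))}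

/-- The distribution `F_θ(dx) = f_θ(x) dx`. -/
def dist (M : DensityFamily Θ) (θ : Θ) : Measure ℝ :=
  volume.withDensity fun x => ENNReal.ofReal (M.density θ x)

instance isProbabilityMeasure_dist (M : DensityFamily Θ) (θ : Θ) :
    IsProbabilityMeasure (M.dist θ) :=
  ⟨by simp [dist, M.lintegral_density θ]⟩

/-- `F_θ` as a point of the space of probability measures on `ℝ` with the weak topology. -/
def law (M : DensityFamily Θ) (θ : Θ) : ProbabilityMeasure ℝ :=
  ⟨M.dist θ, M.isProbabilityMeasure_dist θ⟩

/-- The law `F_θ^∞` of an infinite i.i.d. sample `X₁, X₂, …` (indexed as `x 0, x 1, …`)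
from `F_θ`. -/
def sampleLaw (M : DensityFamily Θ) (θ : Θ) : Measure (ℕ → ℝ) :=
  Measure.infinitePi fun _ : ℕ => M.dist θ

/-- Convergence of parameters in `Θ` is equivalent to Hellinger convergence of the densities. -/
def EuclideanHellingerEquivalent (M : DensityFamily Θ) : Prop :=
  ∀ (θ : Θ) (s : ℕ → Θ),
    Tendsto (fun k => ‖(s k : EuclideanSpace ℝ (Fin p)) - θ‖) atTop (𝓝 0) ↔
      Tendsto (fun k => hellingerDist (M.density (s k)) (M.density θ)) atTop (𝓝 0)

/-- `θ₀` is in the Kullback–Leibler support of `Π`: every set `{θ : KL(f_{θ₀}, f_θ) < ε}`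
has positive prior mass. -/
def InKLSupport (M : DensityFamily Θ) (prior : Measure Θ) (θ₀ : Θ) : Prop :=
  ∀ ε : ℝ, 0 < ε →
    0 < prior {θ : Θ | InformationTheory.klDiv (M.dist θ₀) (M.dist θ) < ENNReal.ofReal ε}

/-- Sequential identifiability at `θ₀`: weak convergence `F_{θ_j} → F_{θ₀}` forces `θ_j → θ₀`. -/
def SequentiallyIdentifiableAt (M : DensityFamily Θ) (θ₀ : Θ) : Prop :=
  ∀ s : ℕ → Θ, Tendsto (fun j => M.law (s j)) atTop (𝓝 (M.law θ₀)) →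
    Tendsto (fun j => ‖(s j : EuclideanSpace ℝ (Fin p)) - θ₀‖) atTop (𝓝 0)

/-- The likelihood `∏_{i=1}^n f_θ(X_i)`. -/
def likelihood (M : DensityFamily Θ) (n : ℕ) (x : ℕ → ℝ) (θ : Θ) : ℝ :=
  ∏ i ∈ Finset.range n, M.density θ (x i)

/-- The posterior `Π(dθ | X_{1:n})` given by Bayes' rule: the prior reweighted by the likelihood
and divided by the normalizing constant. -/
def posterior (M : DensityFamily Θ) (prior : Measure Θ) (n : ℕ) (x : ℕ → ℝ) : Measure Θ :=
  (∫⁻ θ, ENNReal.ofReal (M.likelihood n x θ) ∂prior)⁻¹ •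
    prior.withDensity fun θ => ENNReal.ofReal (M.likelihood n x θ)

/-- The posterior predictive density `y ↦ ∫ f_θ(y) Π(dθ | X_{1:n})`. -/
def predictiveDensity (M : DensityFamily Θ) (prior : Measure Θ) (n : ℕ) (x : ℕ → ℝ) (y : ℝ) : ℝ :=
  ∫ θ, M.density θ y ∂(M.posterior prior n x)

/-- Posterior consistency at `θ₀` (Euclidean neighbourhoods of the parameter). -/
def PosteriorConsistentAt (M : DensityFamily Θ) (prior : Measure Θ) (θ₀ : Θ) : Prop :=
  ∀ ε : ℝ, 0 < ε → ∀ᵐ x ∂(M.sampleLaw θ₀),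
    Tendsto (fun n => M.posterior prior n x
      {θ : Θ | ‖(θ : EuclideanSpace ℝ (Fin p)) - θ₀‖ < ε}ᶜ) atTop (𝓝 0)

/-- Posterior consistency at `θ₀` (Hellinger neighbourhoods of the density). -/
def HellingerPosteriorConsistentAt (M : DensityFamily Θ) (prior : Measure Θ) (θ₀ : Θ) : Prop :=
  ∀ ε : ℝ, 0 < ε → ∀ᵐ x ∂(M.sampleLaw θ₀),
    Tendsto (fun n => M.posterior prior n x
      {θ : Θ | hellingerDist (M.density θ) (M.density θ₀) < ENNReal.ofReal ε}ᶜ) atTop (𝓝 0)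

/-- Almost surely, for every sample size, Bayes' rule gives a probability measure on `Θ` and the
integral defining the posterior predictive density converges at Lebesgue-almost every point. -/
def PosteriorWellDefinedAt (M : DensityFamily Θ) (prior : Measure Θ) (θ₀ : Θ) : Prop :=
  ∀ᵐ x ∂(M.sampleLaw θ₀), ∀ n : ℕ,
    IsProbabilityMeasure (M.posterior prior n x) ∧
      ∀ᵐ y : ℝ, Integrable (fun θ => M.density θ y) (M.posterior prior n x)

/-- The posterior predictive density is a (strongly) Hellinger-consistent estimator of
`f_{θ₀}`. -/
def PredictiveConsistentAt (M : DensityFamily Θ) (prior : Measure Θ) (θ₀ : Θ) : Prop :=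
  ∀ᵐ x ∂(M.sampleLaw θ₀),
    Tendsto (fun n => hellingerDist (M.predictiveDensity prior n x) (M.density θ₀)) atTop (𝓝 0)

end DensityFamily

end

/-! Schwartz's argument. After division by the likelihood at `θ₀`, the posterior mass of a set is a
ratio of integrated likelihood ratios. By the strong law and Fatou's lemma, the Kullback–Leibler
condition keeps the denominator from decaying exponentially
(`ae_tendsto_exp_mul_lintegral_likelihoodRatio`). A bounded test function φ separates `θ₀`
exponentially from the parameters whose φ-mean is off by at least δ, so the numerator over that set
does decay exponentially (`ae_tendsto_posterior_setOf_add_le_integral`).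

The sets of almost surely vanishing posterior complement form a filter, along which the laws
therefore converge weakly to that of `θ₀` (`tendsto_law_posteriorFilter`). Sequential
identifiability turns this into convergence of parameters, and the Euclidean–Hellinger equivalence
into Hellinger convergence. Convexity of the squared Hellinger distance carries it over to the
predictive density. -/

open scoped ENNReal BoundedContinuousFunction

namespace DensityFamily

variable {p : ℕ} {Θ : Set (EuclideanSpace ℝ (Fin p))}

/-- The likelihood ratio `∏_{i<n} f_θ(X_i) / f_{θ₀}(X_i)`, with values in `[0, ∞]`. -/
noncomputable def likelihoodRatio (M : DensityFamily Θ) (θ₀ : Θ) (n : ℕ) (x : ℕ → ℝ) (θ : Θ) :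
    ℝ≥0∞ :=
  ∏ i ∈ Finset.range n,
    (ENNReal.ofReal (M.density θ (x i)) / ENNReal.ofReal (M.density θ₀ (x i)))

/-! ### Measurability and i.i.d. sampling -/

lemma measurable_density_apply (M : DensityFamily Θ) (θ : Θ) : Measurable (M.density θ) :=
  M.measurable_density.comp measurable_prodMk_left

lemma measurable_density_comp (M : DensityFamily Θ) {α : Type*} [MeasurableSpace α]
    {f : α → Θ} {g : α → ℝ} (hf : Measurable f) (hg : Measurable g) :
    Measurable fun a => M.density (f a) (g a) :=
  M.measurable_density.comp (hf.prodMk hg)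

lemma measurable_likelihoodRatio (M : DensityFamily Θ) (θ₀ : Θ) (n : ℕ) :
    Measurable fun q : Θ × (ℕ → ℝ) => M.likelihoodRatio θ₀ n q.2 q.1 := by
  unfold likelihoodRatio
  refine Finset.measurable_prod _ fun i _ => ?_
  exact (M.measurable_density_comp measurable_fst (by fun_prop)).ennreal_ofReal.div
    (M.measurable_density_comp measurable_const (by fun_prop)).ennreal_ofReal

instance isProbabilityMeasure_sampleLaw (M : DensityFamily Θ) (θ : Θ) :
    IsProbabilityMeasure (M.sampleLaw θ) := by
  unfold sampleLaw; infer_instance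

lemma map_eval_sampleLaw (M : DensityFamily Θ) (θ : Θ) (i : ℕ) :
    (M.sampleLaw θ).map (fun x => x i) = M.dist θ :=
  (measurePreserving_eval_infinitePi (fun _ : ℕ => M.dist θ) i).map_eq

lemma ae_sampleLaw_forall (M : DensityFamily Θ) (θ : Θ) {P : ℝ → Prop}
    (h : ∀ᵐ y ∂(M.dist θ), P y) : ∀ᵐ x ∂(M.sampleLaw θ), ∀ i : ℕ, P (x i) := by
  refine ae_all_iff.2 fun i => ?_
  rw [← M.map_eval_sampleLaw θ i] at h
  exact ae_of_ae_map (measurable_pi_apply i).aemeasurable h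

lemma ae_dist_density_pos (M : DensityFamily Θ) (θ : Θ) :
    ∀ᵐ y ∂(M.dist θ), 0 < M.density θ y := by
  unfold dist
  rw [ae_withDensity_iff (M.measurable_density_apply θ).ennreal_ofReal]
  exact ae_of_all _ fun y hy => by simpa using hy

lemma iIndepFun_sampleLaw (M : DensityFamily Θ) (θ : Θ) {β : Type*} [MeasurableSpace β]
    {h : ℝ → β} (hh : Measurable h) :
    iIndepFun (fun (i : ℕ) (x : ℕ → ℝ) => h (x i)) (M.sampleLaw θ) :=
  iIndepFun_infinitePi fun _ => hh

lemma sampleLaw_strong_law (M : DensityFamily Θ) (θ : Θ) {h : ℝ → ℝ} (hh : Measurable h)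
    (hint : Integrable h (M.dist θ)) :
    ∀ᵐ x ∂(M.sampleLaw θ),
      Tendsto (fun n : ℕ => (∑ i ∈ Finset.range n, h (x i)) / n) atTop
        (𝓝 (∫ y, h y ∂(M.dist θ))) := by
  have hmp := measurePreserving_eval_infinitePi (fun _ : ℕ => M.dist θ)
  have hident (i : ℕ) : IdentDistrib (fun x : ℕ → ℝ => x i) (fun x => x 0)
      (M.sampleLaw θ) (M.sampleLaw θ) :=
    ⟨(measurable_pi_apply i).aemeasurable, (measurable_pi_apply 0).aemeasurable,
      by rw [M.map_eval_sampleLaw, M.map_eval_sampleLaw]⟩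
  have key := strong_law_ae_real (μ := M.sampleLaw θ) (fun i x => h (x i))
    ((hmp 0).integrable_comp_of_integrable hint)
    (fun i j hij => (M.iIndepFun_sampleLaw θ hh).indepFun hij)
    (fun i => (hident i).comp hh)
  have e : ∫ x, h (x 0) ∂(M.sampleLaw θ) = ∫ y, h y ∂(M.dist θ) := by
    rw [← M.map_eval_sampleLaw θ 0, integral_map (measurable_pi_apply 0).aemeasurable
      hh.aestronglyMeasurable]
  rw [e] at key
  exact key

lemma lintegral_sampleLaw_prod (M : DensityFamily Θ) (θ : Θ) {g : ℝ → ℝ≥0∞} (hg : Measurable g)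
    (n : ℕ) :
    ∫⁻ x, ∏ i ∈ Finset.range n, g (x i) ∂(M.sampleLaw θ) = (∫⁻ y, g y ∂(M.dist θ)) ^ n := by
  rw [lintegral_prod_eq_prod_lintegral_of_indepFun (Finset.range n) (fun i (x : ℕ → ℝ) => g (x i))
    (M.iIndepFun_sampleLaw θ hg) (fun i => by fun_prop)]
  have e (i : ℕ) : ∫⁻ x, g (x i) ∂(M.sampleLaw θ) = ∫⁻ y, g y ∂(M.dist θ) := by
    rw [← M.map_eval_sampleLaw θ i, lintegral_map hg (measurable_pi_apply i)]
  simp [e]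

/-! ### Upper bounds for integrated likelihood ratios -/

/-- Change of measure. Equality can fail because the mass of `F_θ` where `f_{θ₀}` vanishes is lost.
-/
lemma lintegral_dist_div_mul_le (M : DensityFamily Θ) (θ₀ θ : Θ) {g : ℝ → ℝ≥0∞}
    (hg : Measurable g) :
    ∫⁻ y, ENNReal.ofReal (M.density θ y) / ENNReal.ofReal (M.density θ₀ y) * g y ∂(M.dist θ₀) ≤
      ∫⁻ y, g y ∂(M.dist θ) := by
  have h₀ := (M.measurable_density_apply θ₀).ennreal_ofReal
  have h₁ := (M.measurable_density_apply θ).ennreal_ofReal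
  unfold dist
  rw [lintegral_withDensity_eq_lintegral_mul _ (f := fun y => ENNReal.ofReal (M.density θ₀ y)) h₀
      (g := fun y => ENNReal.ofReal (M.density θ y) / ENNReal.ofReal (M.density θ₀ y) * g y)
      ((h₁.div h₀).mul hg),
    lintegral_withDensity_eq_lintegral_mul _ h₁ hg]
  refine lintegral_mono fun y => ?_
  simp only [Pi.mul_apply, ← mul_assoc]
  gcongr
  exact ENNReal.mul_div_le

/-- The expected integrated likelihood ratio, weighted by a product of statistics. -/
lemma lintegral_setLIntegral_likelihoodRatio_mul_le (M : DensityFamily Θ) (prior : Measure Θ)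
    [IsProbabilityMeasure prior] (θ₀ : Θ) (n : ℕ) {g : ℝ → ℝ≥0∞} (hg : Measurable g)
    (A : Set Θ) :
    ∫⁻ x, (∫⁻ θ in A, M.likelihoodRatio θ₀ n x θ ∂prior) * ∏ i ∈ Finset.range n, g (x i)
        ∂(M.sampleLaw θ₀) ≤
      ∫⁻ θ in A, (∫⁻ y, g y ∂(M.dist θ)) ^ n ∂prior := by
  have hm := M.measurable_likelihoodRatio θ₀ n
  have hgm : Measurable fun x : ℕ → ℝ => ∏ i ∈ Finset.range n, g (x i) :=
    Finset.measurable_prod _ fun i _ => by fun_prop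
  have e (x : ℕ → ℝ) :
      (∫⁻ θ in A, M.likelihoodRatio θ₀ n x θ ∂prior) * ∏ i ∈ Finset.range n, g (x i) =
      ∫⁻ θ in A, M.likelihoodRatio θ₀ n x θ * ∏ i ∈ Finset.range n, g (x i) ∂prior :=
    (lintegral_mul_const _ (hm.comp measurable_prodMk_right)).symm
  simp_rw [e]
  rw [lintegral_lintegral_swap
    ((hm.comp measurable_swap).mul (hgm.comp measurable_fst)).aemeasurable]
  refine lintegral_mono fun θ => ?_
  have h₀ := (M.measurable_density_apply θ₀).ennreal_ofReal
  have h₁ := (M.measurable_density_apply θ).ennreal_ofReal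
  simp only [likelihoodRatio, ← Finset.prod_mul_distrib]
  rw [M.lintegral_sampleLaw_prod θ₀ (g := fun y => ENNReal.ofReal (M.density θ y) /
    ENNReal.ofReal (M.density θ₀ y) * g y) ((h₁.div h₀).mul hg)]
  exact pow_le_pow_left' (M.lintegral_dist_div_mul_le θ₀ θ hg) n

/-- The expectations are at most `r ^ n`, hence summable, so the series of these variables is almost
surely finite and its terms tend to 0. -/
lemma ae_tendsto_setLIntegral_likelihoodRatio_mul (M : DensityFamily Θ) (prior : Measure Θ)
    [IsProbabilityMeasure prior] (θ₀ : Θ) {g : ℝ → ℝ≥0∞} (hg : Measurable g)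
    {A : Set Θ} {r : ℝ≥0∞} (hr : r < 1)
    (h : ∀ θ ∈ A, ∫⁻ y, g y ∂(M.dist θ) ≤ r) :
    ∀ᵐ x ∂(M.sampleLaw θ₀), Tendsto (fun n : ℕ =>
      (∫⁻ θ in A, M.likelihoodRatio θ₀ n x θ ∂prior) * ∏ i ∈ Finset.range n, g (x i))
        atTop (𝓝 0) := by
  have hle (n : ℕ) : ∫⁻ x, (∫⁻ θ in A, M.likelihoodRatio θ₀ n x θ ∂prior) *
      ∏ i ∈ Finset.range n, g (x i) ∂(M.sampleLaw θ₀) ≤ r ^ n := by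
    refine (M.lintegral_setLIntegral_likelihoodRatio_mul_le prior θ₀ n hg A).trans ?_
    calc ∫⁻ θ in A, (∫⁻ y, g y ∂(M.dist θ)) ^ n ∂prior
        ≤ ∫⁻ θ in A, r ^ n ∂prior :=
          setLIntegral_mono measurable_const fun θ hθ => by gcongr; exact h θ hθ
      _ ≤ r ^ n := by
          rw [setLIntegral_const]
          exact mul_le_of_le_one_right' prob_le_one
  have hmeas (n : ℕ) : Measurable fun x : ℕ → ℝ =>
      (∫⁻ θ in A, M.likelihoodRatio θ₀ n x θ ∂prior) * ∏ i ∈ Finset.range n, g (x i) :=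
    ((M.measurable_likelihoodRatio θ₀ n).comp measurable_swap).lintegral_prod_right'.mul
      (Finset.measurable_prod _ fun i _ => by fun_prop)
  have hsum : ∫⁻ x, ∑' n : ℕ, (∫⁻ θ in A, M.likelihoodRatio θ₀ n x θ ∂prior) *
      ∏ i ∈ Finset.range n, g (x i) ∂(M.sampleLaw θ₀) ≠ ∞ := by
    rw [lintegral_tsum fun n => (hmeas n).aemeasurable]
    refine ne_top_of_le_ne_top ?_ (ENNReal.tsum_le_tsum hle)
    rw [ENNReal.tsum_geometric]
    exact ENNReal.inv_ne_top.2 (tsub_pos_of_lt hr).ne'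
  filter_upwards [ae_lt_top (Measurable.tsum hmeas) hsum] with x hx
  exact ENNReal.tendsto_atTop_zero_of_tsum_ne_top hx.ne

lemma ae_lintegral_likelihoodRatio_ne_top (M : DensityFamily Θ) (prior : Measure Θ)
    [IsProbabilityMeasure prior] (θ₀ : Θ) :
    ∀ᵐ x ∂(M.sampleLaw θ₀), ∀ n, ∫⁻ θ, M.likelihoodRatio θ₀ n x θ ∂prior ≠ ∞ := by
  refine ae_all_iff.2 fun n => ?_
  have h := M.lintegral_setLIntegral_likelihoodRatio_mul_le prior θ₀ n
    (g := fun _ => 1) measurable_const Set.univ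
  simp only [Measure.restrict_univ, Finset.prod_const_one, mul_one, lintegral_const,
    measure_univ, one_pow] at h
  have hm : Measurable fun x : ℕ → ℝ => ∫⁻ θ, M.likelihoodRatio θ₀ n x θ ∂prior :=
    ((M.measurable_likelihoodRatio θ₀ n).comp measurable_swap).lintegral_prod_right'
  filter_upwards [ae_lt_top hm (h.trans_lt ENNReal.one_lt_top).ne] with x hx using hx.ne

/-! ### Lower bound for the normalizing constant -/

/-- Finite Kullback-Leibler divergence makes the log-likelihood ratio integrable, with the expected
integral. -/
lemma integrable_log_density_div (M : DensityFamily Θ) (θ₀ θ : Θ)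
    (h : InformationTheory.klDiv (M.dist θ₀) (M.dist θ) ≠ ∞) :
    (∀ᵐ y ∂(M.dist θ₀), 0 < M.density θ y) ∧
    Integrable (fun y => Real.log (M.density θ y / M.density θ₀ y)) (M.dist θ₀) ∧
      ∫ y, Real.log (M.density θ y / M.density θ₀ y) ∂(M.dist θ₀) =
        -(InformationTheory.klDiv (M.dist θ₀) (M.dist θ)).toReal := by
  obtain ⟨hac, hint⟩ := InformationTheory.klDiv_ne_top_iff.1 h
  have hpos : ∀ᵐ y ∂(M.dist θ₀), 0 < M.density θ y := hac (M.ae_dist_density_pos θ)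
  have h₀ := (M.measurable_density_apply θ₀).ennreal_ofReal
  have h₁ := (M.measurable_density_apply θ).ennreal_ofReal
  have hrn : (fun y => ENNReal.ofReal (M.density θ₀ y)) =ᵐ[volume]
      (fun y => ENNReal.ofReal (M.density θ y)) * (M.dist θ₀).rnDeriv (M.dist θ) := by
    rw [← withDensity_eq_iff h₀.aemeasurable
      (h₁.mul (Measure.measurable_rnDeriv _ _)).aemeasurable (by simp [M.lintegral_density θ₀]),
      withDensity_mul _ h₁ (Measure.measurable_rnDeriv _ _)]
    exact (Measure.withDensity_rnDeriv_eq _ _ hac).symm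
  have hrn' := (withDensity_absolutelyContinuous volume
    (fun y => ENNReal.ofReal (M.density θ₀ y))).ae_le hrn
  have heq : (fun y => Real.log (M.density θ y / M.density θ₀ y)) =ᵐ[M.dist θ₀]
      fun y => - llr (M.dist θ₀) (M.dist θ) y := by
    filter_upwards [hpos, M.ae_dist_density_pos θ₀, hrn'] with y hy hy₀ he
    have he' : M.density θ₀ y =
        M.density θ y * ((M.dist θ₀).rnDeriv (M.dist θ) y).toReal := by
      have := congrArg ENNReal.toReal he
      simpa [ENNReal.toReal_ofReal, M.density_nonneg] using this
    rw [llr, ← Real.log_inv]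
    congr 1
    have : ((M.dist θ₀).rnDeriv (M.dist θ) y).toReal = M.density θ₀ y / M.density θ y := by
      rw [he']; field_simp
    rw [this, inv_div]
  refine ⟨hpos, hint.neg.congr heq.symm, ?_⟩
  rw [integral_congr_ae heq, integral_neg,
    InformationTheory.toReal_klDiv_of_measure_eq hac (by simp)]

lemma likelihoodRatio_eq_exp (M : DensityFamily Θ) (θ₀ θ : Θ) {x : ℕ → ℝ}
    (h₀ : ∀ i, 0 < M.density θ₀ (x i)) (h : ∀ i, 0 < M.density θ (x i)) (n : ℕ) :
    M.likelihoodRatio θ₀ n x θ = ENNReal.ofReal (Real.exp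
      (∑ i ∈ Finset.range n, Real.log (M.density θ (x i) / M.density θ₀ (x i)))) := by
  rw [Real.exp_sum, ENNReal.ofReal_prod_of_nonneg fun i _ => (Real.exp_pos _).le]
  refine Finset.prod_congr rfl fun i _ => ?_
  rw [Real.exp_log (div_pos (h i) (h₀ i)), ENNReal.ofReal_div_of_pos (h₀ i)]

/-- By the strong law the exponent is `n` times a quantity converging to `c - KL > 0`. -/
lemma ae_tendsto_exp_mul_likelihoodRatio (M : DensityFamily Θ) (θ₀ θ : Θ) {c : ℝ}
    (h : InformationTheory.klDiv (M.dist θ₀) (M.dist θ) < ENNReal.ofReal c) :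
    ∀ᵐ x ∂(M.sampleLaw θ₀), Tendsto (fun n : ℕ =>
      ENNReal.ofReal (Real.exp (c * n)) * M.likelihoodRatio θ₀ n x θ) atTop (𝓝 ∞) := by
  obtain ⟨hpos, hint, heq⟩ := M.integrable_log_density_div θ₀ θ h.ne_top
  have hlt : (InformationTheory.klDiv (M.dist θ₀) (M.dist θ)).toReal < c :=
    (ENNReal.lt_ofReal_iff_toReal_lt h.ne_top).1 h
  have hm : Measurable fun y => Real.log (M.density θ y / M.density θ₀ y) :=
    ((M.measurable_density_apply θ).div (M.measurable_density_apply θ₀)).log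
  filter_upwards [M.sampleLaw_strong_law θ₀ hm hint, M.ae_sampleLaw_forall θ₀ hpos,
    M.ae_sampleLaw_forall θ₀ (M.ae_dist_density_pos θ₀)] with x hx hθ hθ₀
  rw [heq] at hx
  have h1 := (tendsto_const_nhds (x := c)).add hx
  have h2 := (h1.pos_mul_atTop (by linarith) tendsto_natCast_atTop_atTop :
    Tendsto _ atTop atTop)
  refine (ENNReal.tendsto_ofReal_atTop.comp (Real.tendsto_exp_atTop.comp h2)).congr' ?_
  filter_upwards [eventually_gt_atTop 0] with n hn
  have hn' : (n : ℝ) ≠ 0 := by positivity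
  rw [M.likelihoodRatio_eq_exp θ₀ θ hθ₀ hθ, ← ENNReal.ofReal_mul (Real.exp_pos _).le,
    ← Real.exp_add]
  simp only [Function.comp_apply]
  congr 2
  field_simp

/-- The integrated likelihood ratio decays more slowly than any exponential. -/
lemma ae_tendsto_exp_mul_lintegral_likelihoodRatio (M : DensityFamily Θ) (prior : Measure Θ)
    [IsProbabilityMeasure prior] (θ₀ : Θ) (hKL : M.InKLSupport prior θ₀) {c : ℝ} (hc : 0 < c) :
    ∀ᵐ x ∂(M.sampleLaw θ₀), Tendsto (fun n : ℕ =>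
      ENNReal.ofReal (Real.exp (c * n)) * ∫⁻ θ, M.likelihoodRatio θ₀ n x θ ∂prior)
        atTop (𝓝 ∞) := by
  set G : Set (Θ × (ℕ → ℝ)) := {q | Tendsto (fun n : ℕ =>
      ENNReal.ofReal (Real.exp (c * n)) * M.likelihoodRatio θ₀ n q.2 q.1) atTop (𝓝 ∞)} with hG
  have hGm : MeasurableSet G :=
    measurableSet_tendsto _ fun n => (M.measurable_likelihoodRatio θ₀ n).const_mul _
  -- A measurable superset of the Kullback–Leibler neighbourhood, whose own measurability is then
  -- not needed for exchanging the almost-everywhere quantifiers.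
  set K : Set Θ := {θ | M.sampleLaw θ₀ (Prod.mk θ ⁻¹' Gᶜ) = 0} with hK
  have hKm : MeasurableSet K := by
    have := measurable_measure_prodMk_left (ν := M.sampleLaw θ₀) hGm.compl
    exact this (measurableSet_singleton 0)
  have hKpos : prior K ≠ 0 := by
    refine ((hKL c hc).trans_le (measure_mono fun θ hθ => ?_)).ne'
    exact M.ae_tendsto_exp_mul_likelihoodRatio θ₀ θ hθ
  have h1 : ∀ᵐ θ ∂(prior.restrict K), ∀ᵐ x ∂(M.sampleLaw θ₀), (θ, x) ∈ G :=
    (ae_restrict_iff' hKm).2 (ae_of_all _ fun θ hθ => hθ)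
  rw [Measure.ae_ae_comm hGm] at h1
  filter_upwards [h1] with x hx
  have hmeas (n : ℕ) : Measurable fun θ : Θ =>
      ENNReal.ofReal (Real.exp (c * n)) * M.likelihoodRatio θ₀ n x θ :=
    ((M.measurable_likelihoodRatio θ₀ n).comp measurable_prodMk_right).const_mul _
  have hlim : (∞ : ℝ≥0∞) ≤ liminf (fun n : ℕ => ENNReal.ofReal (Real.exp (c * n)) *
      ∫⁻ θ, M.likelihoodRatio θ₀ n x θ ∂prior) atTop := by
    calc (∞ : ℝ≥0∞) = ∫⁻ _ in K, ∞ ∂prior := by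
          rw [setLIntegral_const, ENNReal.top_mul hKpos]
      _ = ∫⁻ θ in K, liminf (fun n : ℕ =>
            ENNReal.ofReal (Real.exp (c * n)) * M.likelihoodRatio θ₀ n x θ) atTop ∂prior :=
          lintegral_congr_ae (hx.mono fun θ hθ => (Tendsto.liminf_eq hθ).symm)
      _ ≤ liminf (fun n : ℕ => ∫⁻ θ in K,
            ENNReal.ofReal (Real.exp (c * n)) * M.likelihoodRatio θ₀ n x θ ∂prior) atTop :=
          lintegral_liminf_le hmeas
      _ ≤ _ := by
          refine liminf_le_liminf (Eventually.of_forall fun n => ?_)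
          refine (setLIntegral_le_lintegral _ _).trans_eq ?_
          exact lintegral_const_mul _
            ((M.measurable_likelihoodRatio θ₀ n).comp measurable_prodMk_right)
  exact tendsto_of_le_liminf_of_limsup_le hlim le_top

/-! ### The posterior as a quotient of integrated likelihood ratios -/

lemma ofReal_likelihood_eq_mul (M : DensityFamily Θ) (θ₀ : Θ) {x : ℕ → ℝ}
    (h₀ : ∀ i, 0 < M.density θ₀ (x i)) (n : ℕ) (θ : Θ) :
    ENNReal.ofReal (M.likelihood n x θ) =
      (∏ i ∈ Finset.range n, ENNReal.ofReal (M.density θ₀ (x i))) *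
        M.likelihoodRatio θ₀ n x θ := by
  unfold likelihood likelihoodRatio
  rw [ENNReal.ofReal_prod_of_nonneg fun i _ => M.density_nonneg _ _, ← Finset.prod_mul_distrib]
  refine Finset.prod_congr rfl fun i _ => ?_
  rw [ENNReal.mul_div_cancel (by simpa using h₀ i) ENNReal.ofReal_ne_top]

lemma posterior_apply (M : DensityFamily Θ) (prior : Measure Θ) [IsProbabilityMeasure prior]
    (θ₀ : Θ) {x : ℕ → ℝ} (h₀ : ∀ i, 0 < M.density θ₀ (x i)) (n : ℕ) (A : Set Θ) :
    M.posterior prior n x A = (∫⁻ θ, M.likelihoodRatio θ₀ n x θ ∂prior)⁻¹ *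
      ∫⁻ θ in A, M.likelihoodRatio θ₀ n x θ ∂prior := by
  have hm : Measurable fun θ => M.likelihoodRatio θ₀ n x θ :=
    (M.measurable_likelihoodRatio θ₀ n).comp measurable_prodMk_right
  have hC : ∏ i ∈ Finset.range n, ENNReal.ofReal (M.density θ₀ (x i)) ≠ 0 :=
    Finset.prod_ne_zero_iff.2 fun i _ => by simpa using h₀ i
  have hC' : ∏ i ∈ Finset.range n, ENNReal.ofReal (M.density θ₀ (x i)) ≠ ∞ :=
    ENNReal.prod_ne_top fun i _ => ENNReal.ofReal_ne_top
  rw [posterior, Measure.smul_apply, withDensity_apply', smul_eq_mul]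
  simp_rw [M.ofReal_likelihood_eq_mul θ₀ h₀]
  rw [lintegral_const_mul _ hm, lintegral_const_mul _ hm, ENNReal.mul_inv (.inl hC) (.inl hC'),
    mul_mul_mul_comm, ENNReal.inv_mul_cancel hC hC', one_mul]

/-- A product that vanishes at `n` vanishes at every later index, so a zero integral would persist
and contradict the divergence to `∞`. -/
lemma ae_lintegral_likelihoodRatio_ne_zero (M : DensityFamily Θ) (prior : Measure Θ)
    [IsProbabilityMeasure prior] (θ₀ : Θ) (hKL : M.InKLSupport prior θ₀) :
    ∀ᵐ x ∂(M.sampleLaw θ₀), ∀ n, ∫⁻ θ, M.likelihoodRatio θ₀ n x θ ∂prior ≠ 0 := by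
  filter_upwards [M.ae_tendsto_exp_mul_lintegral_likelihoodRatio prior θ₀ hKL one_pos]
    with x hx n hn
  have hm (n : ℕ) : Measurable fun θ => M.likelihoodRatio θ₀ n x θ :=
    (M.measurable_likelihoodRatio θ₀ n).comp measurable_prodMk_right
  obtain ⟨m, hpos, hnm⟩ := ((hx.eventually_ne ENNReal.top_ne_zero).and
    (eventually_ge_atTop n)).exists
  refine hpos (mul_eq_zero_of_right _ ?_)
  rw [lintegral_eq_zero_iff (hm _)] at hn ⊢
  filter_upwards [hn] with θ hθ
  unfold likelihoodRatio at hθ ⊢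
  obtain ⟨i, hi, hi0⟩ := Finset.prod_eq_zero_iff.1 hθ
  exact Finset.prod_eq_zero
    (Finset.mem_range.2 ((Finset.mem_range.1 hi).trans_le hnm)) hi0

lemma ae_isProbabilityMeasure_posterior (M : DensityFamily Θ) (prior : Measure Θ)
    [IsProbabilityMeasure prior] (θ₀ : Θ) (hKL : M.InKLSupport prior θ₀) :
    ∀ᵐ x ∂(M.sampleLaw θ₀), ∀ n, IsProbabilityMeasure (M.posterior prior n x) := by
  filter_upwards [M.ae_lintegral_likelihoodRatio_ne_zero prior θ₀ hKL,
    M.ae_lintegral_likelihoodRatio_ne_top prior θ₀,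
    M.ae_sampleLaw_forall θ₀ (M.ae_dist_density_pos θ₀)] with x h1 h2 h3 n
  refine ⟨?_⟩
  rw [M.posterior_apply prior θ₀ h3, Measure.restrict_univ, ENNReal.inv_mul_cancel (h1 n) (h2 n)]

/-! ### Exponential separation and weak consistency -/

/-- A set of parameters that is exponentially separated from `θ₀` by an additive statistic
has vanishing posterior mass. -/
lemma ae_tendsto_posterior_of_lintegral_exp_le (M : DensityFamily Θ) (prior : Measure Θ)
    [IsProbabilityMeasure prior] (θ₀ : Θ) (hKL : M.InKLSupport prior θ₀) {u : ℝ → ℝ}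
    (hu : Measurable u) (hint : Integrable u (M.dist θ₀)) (hpos : 0 < ∫ y, u y ∂(M.dist θ₀))
    {A : Set Θ} {r : ℝ≥0∞} (hr : r < 1)
    (h : ∀ θ ∈ A, ∫⁻ y, ENNReal.ofReal (Real.exp (u y)) ∂(M.dist θ) ≤ r) :
    ∀ᵐ x ∂(M.sampleLaw θ₀), Tendsto (fun n => M.posterior prior n x A) atTop (𝓝 0) := by
  -- With `c` below the mean of `u`, the product of the `exp (u (x i))` eventually dominates `exp (c
  -- * n)`. So the numerator times `exp (c * n)` tends to 0, while the denominator times the same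
  -- factor tends to `∞`.
  obtain ⟨c, hc, hcu⟩ := exists_between hpos
  filter_upwards [M.ae_tendsto_exp_mul_lintegral_likelihoodRatio prior θ₀ hKL hc,
    M.ae_tendsto_setLIntegral_likelihoodRatio_mul prior θ₀ hu.exp.ennreal_ofReal hr h,
    M.sampleLaw_strong_law θ₀ hu hint,
    M.ae_sampleLaw_forall θ₀ (M.ae_dist_density_pos θ₀)] with x hD hN hS h₀
  have hN' : Tendsto (fun n : ℕ => (∫⁻ θ in A, M.likelihoodRatio θ₀ n x θ ∂prior) *
      ENNReal.ofReal (Real.exp (c * n))) atTop (𝓝 0) := by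
    refine tendsto_of_tendsto_of_tendsto_of_le_of_le' tendsto_const_nhds hN
      (Eventually.of_forall fun n => zero_le) ?_
    filter_upwards [hS.eventually_const_lt hcu, eventually_gt_atTop 0] with n hn hn0
    rw [← ENNReal.ofReal_prod_of_nonneg fun i _ => (Real.exp_pos _).le, ← Real.exp_sum]
    have : (0 : ℝ) < n := by positivity
    gcongr
    exact ((lt_div_iff₀ this).1 hn).le
  have hD' := tendsto_inv_iff.2 hD
  rw [ENNReal.inv_top] at hD'
  have hND := ENNReal.Tendsto.mul hD' (.inr ENNReal.zero_ne_top) hN' (.inr ENNReal.zero_ne_top)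
  rw [mul_zero] at hND
  refine hND.congr fun n => ?_
  have he : ENNReal.ofReal (Real.exp (c * n)) ≠ 0 := by simpa using Real.exp_pos _
  rw [M.posterior_apply prior θ₀ h₀, ENNReal.mul_inv (.inl he) (.inl ENNReal.ofReal_ne_top),
    mul_comm (∫⁻ θ in A, _ ∂prior), mul_mul_mul_comm,
    ENNReal.inv_mul_cancel he ENNReal.ofReal_ne_top, one_mul]

/-- The posterior mass of parameters whose `φ`-mean exceeds that of `θ₀` by `δ` vanishes. -/
lemma ae_tendsto_posterior_setOf_add_le_integral (M : DensityFamily Θ) (prior : Measure Θ)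
    [IsProbabilityMeasure prior] (θ₀ : Θ) (hKL : M.InKLSupport prior θ₀) (φ : ℝ →ᵇ ℝ)
    {δ : ℝ} (hδ : 0 < δ) :
    ∀ᵐ x ∂(M.sampleLaw θ₀), Tendsto (fun n => M.posterior prior n x
      {θ | ∫ y, φ y ∂(M.dist θ₀) + δ ≤ ∫ y, φ y ∂(M.dist θ)}) atTop (𝓝 0) := by
  set m := ∫ y, φ y ∂(M.dist θ₀) with hm
  set C := 1 + δ + ‖φ‖ + |m| with hC
  have hC1 : 1 ≤ C := by have := norm_nonneg φ; have := abs_nonneg m; linarith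
  have hCδ : δ ≤ C := by have := norm_nonneg φ; have := abs_nonneg m; linarith
  -- The mean of `v` is `δ / 2` at `θ₀` and at most `-δ / 2` on the set in question; `C` bounds
  -- `|v|`.
  set v : ℝ → ℝ := fun y => m + δ / 2 - φ y with hv
  have hφi (θ : Θ) : Integrable φ (M.dist θ) := φ.integrable _
  have hvi (θ : Θ) : Integrable v (M.dist θ) := (integrable_const _).sub (hφi θ)
  have hvm : Measurable v := (measurable_const.sub φ.continuous.measurable)
  have hvC (y : ℝ) : |v y| ≤ C := by
    have h1 := (abs_le.1 ((Real.norm_eq_abs _).symm.trans_le (φ.norm_coe_le_norm y)))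
    have h2 := abs_le.1 (le_refl |m|)
    rw [abs_le]
    constructor <;> simp only [hv] <;> linarith
  have hvint (θ : Θ) : ∫ y, v y ∂(M.dist θ) = m + δ / 2 - ∫ y, φ y ∂(M.dist θ) := by
    rw [hv, integral_sub (integrable_const _) (hφi θ)]
    simp
  -- Small enough that `exp t ≤ 1 + t + t ^ 2` applies to `t = l * v y` and that the quadratic term
  -- is at most `l * δ / 4`, half of the gain `l * δ / 2` from the linear term.
  set l := δ / (4 * C ^ 2) with hl
  have hl0 : 0 < l := by positivity
  have hlC : l * C ≤ 1 := by
    rw [hl, div_mul_eq_mul_div, div_le_one (by positivity)]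
    nlinarith
  have hlC2 : l ^ 2 * C ^ 2 = l * δ / 4 := by
    rw [hl]; field_simp
  have hexp (y : ℝ) : Real.exp (l * v y) ≤ 1 + l * v y + l * δ / 4 := by
    have h1 : |l * v y| ≤ 1 := by
      rw [abs_mul, abs_of_pos hl0]
      exact (mul_le_mul_of_nonneg_left (hvC y) hl0.le).trans hlC
    have h2 := (abs_le.1 (Real.abs_exp_sub_one_sub_id_le h1)).2
    have h3 : (l * v y) ^ 2 ≤ l ^ 2 * C ^ 2 := by
      rw [mul_pow]
      exact mul_le_mul_of_nonneg_left
        (sq_le_sq' (abs_le.1 (hvC y)).1 (abs_le.1 (hvC y)).2) (sq_nonneg l)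
    linarith
  refine M.ae_tendsto_posterior_of_lintegral_exp_le prior θ₀ hKL (u := fun y => l * v y)
    (r := ENNReal.ofReal (1 - l * δ / 4))
    (hvm.const_mul l) ((hvi θ₀).const_mul l) ?_ ?_ ?_
  · rw [integral_const_mul, hvint, ← hm]
    exact mul_pos hl0 (by linarith)
  · rw [ENNReal.ofReal_lt_one]
    have := mul_pos hl0 hδ
    linarith
  · intro θ hθ
    have hi' : Integrable (fun y => 1 + l * v y) (M.dist θ) :=
      (integrable_const _).add ((hvi θ).const_mul l)
    have hi : Integrable (fun y => 1 + l * v y + l * δ / 4) (M.dist θ) :=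
      hi'.add (integrable_const _)
    calc ∫⁻ y, ENNReal.ofReal (Real.exp (l * v y)) ∂(M.dist θ)
        ≤ ∫⁻ y, ENNReal.ofReal (1 + l * v y + l * δ / 4) ∂(M.dist θ) :=
          lintegral_mono fun y => ENNReal.ofReal_le_ofReal (hexp y)
      _ = ENNReal.ofReal (∫ y, (1 + l * v y + l * δ / 4) ∂(M.dist θ)) :=
          (ofReal_integral_eq_lintegral_ofReal hi
            (ae_of_all _ fun y => (Real.exp_pos _).le.trans (hexp y))).symm
      _ ≤ ENNReal.ofReal (1 - l * δ / 4) := by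
          refine ENNReal.ofReal_le_ofReal ?_
          rw [integral_add hi' (integrable_const _),
            integral_add (integrable_const _) ((hvi θ).const_mul l), integral_const_mul, hvint]
          simp only [integral_const, probReal_univ, one_smul]
          have : m + δ ≤ ∫ y, φ y ∂(M.dist θ) := hθ
          nlinarith

/-- The filter of sets of parameters on which the posterior concentrates almost surely. -/
def posteriorFilter (M : DensityFamily Θ) (prior : Measure Θ) (θ₀ : Θ) : Filter Θ where
  sets := {V | ∀ᵐ x ∂(M.sampleLaw θ₀), Tendsto (fun n => M.posterior prior n x Vᶜ) atTop (𝓝 0)}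
  univ_sets := by simp
  sets_of_superset {V W} hV hVW := by
    refine Eventually.mono (show ∀ᵐ x ∂_, _ from hV) fun x hx => ?_
    exact tendsto_of_tendsto_of_tendsto_of_le_of_le tendsto_const_nhds hx
      (fun n => zero_le) fun n => measure_mono (Set.compl_subset_compl.2 hVW)
  inter_sets {V W} hV hW := by
    refine ((show ∀ᵐ x ∂_, _ from hV).and (show ∀ᵐ x ∂_, _ from hW)).mono fun x ⟨hx, hy⟩ => ?_
    have h := hx.add hy
    rw [add_zero] at h
    refine tendsto_of_tendsto_of_tendsto_of_le_of_le tendsto_const_nhds h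
      (fun n => zero_le) fun n => ?_
    rw [Set.compl_inter]
    exact measure_union_le _ _

lemma mem_posteriorFilter {M : DensityFamily Θ} {prior : Measure Θ} {θ₀ : Θ} {V : Set Θ} :
    V ∈ M.posteriorFilter prior θ₀ ↔ ∀ᵐ x ∂(M.sampleLaw θ₀),
      Tendsto (fun n => M.posterior prior n x Vᶜ) atTop (𝓝 0) :=
  Iff.rfl

/-- Weak posterior consistency (Schwartz). -/
lemma tendsto_law_posteriorFilter (M : DensityFamily Θ) (prior : Measure Θ)
    [IsProbabilityMeasure prior] (θ₀ : Θ) (hKL : M.InKLSupport prior θ₀) :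
    Tendsto M.law (M.posteriorFilter prior θ₀) (𝓝 (M.law θ₀)) := by
  have upper (φ : ℝ →ᵇ ℝ) {δ : ℝ} (hδ : 0 < δ) : ∀ᶠ θ in M.posteriorFilter prior θ₀,
      ∫ y, φ y ∂(M.dist θ) < ∫ y, φ y ∂(M.dist θ₀) + δ := by
    rw [Filter.Eventually, mem_posteriorFilter]
    simpa only [Set.compl_ofPred, not_lt] using
      M.ae_tendsto_posterior_setOf_add_le_integral prior θ₀ hKL φ hδ
  rw [ProbabilityMeasure.tendsto_iff_forall_integral_tendsto]
  intro φ
  change Tendsto (fun θ => ∫ y, φ y ∂(M.dist θ)) _ (𝓝 (∫ y, φ y ∂(M.dist θ₀)))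
  refine tendsto_order.2 ⟨fun a ha => ?_, fun a ha => ?_⟩
  -- The one-sided bound for `-φ` is the lower bound for `φ`.
  · filter_upwards [upper (-φ) (sub_pos.2 ha)] with θ hθ
    simp only [BoundedContinuousFunction.coe_neg, Pi.neg_apply, integral_neg] at hθ
    linarith
  · filter_upwards [upper φ (sub_pos.2 ha)] with θ hθ
    linarith

lemma posteriorFilter_le_comap_law (M : DensityFamily Θ) (prior : Measure Θ)
    [IsProbabilityMeasure prior] (θ₀ : Θ) (hKL : M.InKLSupport prior θ₀) :
    M.posteriorFilter prior θ₀ ≤ comap M.law (𝓝 (M.law θ₀)) :=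
  tendsto_iff_comap.1 (M.tendsto_law_posteriorFilter prior θ₀ hKL)

/-! ### From weak to Euclidean and Hellinger convergence -/

/-- Sequences suffice: the weak topology on laws over `ℝ` is first countable, so the pulled-back
filter is countably generated. -/
lemma SequentiallyIdentifiableAt.tendsto_norm_sub {M : DensityFamily Θ} {θ₀ : Θ}
    (hid : M.SequentiallyIdentifiableAt θ₀) :
    Tendsto (fun θ : Θ => ‖(θ : EuclideanSpace ℝ (Fin p)) - θ₀‖) (comap M.law (𝓝 (M.law θ₀)))
      (𝓝 0) :=
  tendsto_of_seq_tendsto fun s hs => hid s (tendsto_comap_iff.1 hs)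

lemma SequentiallyIdentifiableAt.tendsto_hellingerDist {M : DensityFamily Θ} {θ₀ : Θ}
    (hid : M.SequentiallyIdentifiableAt θ₀) (hM : M.EuclideanHellingerEquivalent) :
    Tendsto (fun θ : Θ => hellingerDist (M.density θ) (M.density θ₀))
      (comap M.law (𝓝 (M.law θ₀))) (𝓝 0) :=
  tendsto_of_seq_tendsto fun s hs => (hM θ₀ s).1 (hid s (tendsto_comap_iff.1 hs))

/-! ### Mixtures of densities and the predictive density -/

lemma ae_integrable_density (M : DensityFamily Θ) (Q : Measure Θ) [IsProbabilityMeasure Q] :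
    ∀ᵐ y : ℝ, Integrable (fun θ => M.density θ y) Q := by
  have hm : Measurable fun q : ℝ × Θ => ENNReal.ofReal (M.density q.2 q.1) :=
    (M.measurable_density_comp measurable_snd measurable_fst).ennreal_ofReal
  have h : ∫⁻ y, ∫⁻ θ, ENNReal.ofReal (M.density θ y) ∂Q ≠ ∞ := by
    rw [lintegral_lintegral_swap hm.aemeasurable]
    simp [M.lintegral_density]
  filter_upwards [ae_lt_top hm.lintegral_prod_right' h] with y hy
  refine ⟨(M.measurable_density_comp measurable_id measurable_const).aestronglyMeasurable, ?_⟩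
  rwa [hasFiniteIntegral_iff_ofReal (ae_of_all _ fun θ => M.density_nonneg θ y)]

end DensityFamily

lemma hellingerDist_sq (f g : ℝ → ℝ) : hellingerDist f g ^ 2 =
    ∫⁻ x, ENNReal.ofReal ((Real.sqrt (f x) - Real.sqrt (g x)) ^ 2) := by
  rw [hellingerDist, ← ENNReal.rpow_natCast, ← ENNReal.rpow_mul]
  norm_num

/-- Jensen's inequality for `k ↦ (√k - b)²`. -/
lemma ofReal_sqrt_integral_sub_sq_le {α : Type*} [MeasurableSpace α] (Q : Measure α)
    [IsProbabilityMeasure Q] {k : α → ℝ} (hk : Integrable k Q) (hk0 : ∀ a, 0 ≤ k a) {b : ℝ}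
    (hb : 0 ≤ b) :
    ENNReal.ofReal ((Real.sqrt (∫ a, k a ∂Q) - b) ^ 2) ≤
      ∫⁻ a, ENNReal.ofReal ((Real.sqrt (k a) - b) ^ 2) ∂Q := by
  have hs : Integrable (fun a => Real.sqrt (k a)) Q := by
    refine (hk.add (integrable_const 1)).mono'
      (Real.continuous_sqrt.comp_aestronglyMeasurable hk.1) (ae_of_all _ fun a => ?_)
    rw [Real.norm_of_nonneg (Real.sqrt_nonneg _)]
    have := Real.sq_sqrt (hk0 a)
    simp only [Pi.add_apply]
    nlinarith [sq_nonneg (Real.sqrt (k a) - 1), Real.sqrt_nonneg (k a)]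
  have he (a : α) : (Real.sqrt (k a) - b) ^ 2 = k a - 2 * b * Real.sqrt (k a) + b ^ 2 := by
    rw [sub_sq, Real.sq_sqrt (hk0 a)]; ring
  have hi : Integrable (fun a => k a - 2 * b * Real.sqrt (k a)) Q := hk.sub (hs.const_mul _)
  -- Integrate the tangent-line bound `√k ≤ k / (2 * s) + s / 2` at `s = √(∫ k)`; the case `s = 0`
  -- is separate.
  have hsqrt : ∫ a, Real.sqrt (k a) ∂Q ≤ Real.sqrt (∫ a, k a ∂Q) := by
    rcases (integral_nonneg hk0 : 0 ≤ ∫ a, k a ∂Q).eq_or_lt with h | h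
    · have := (integral_eq_zero_iff_of_nonneg hk0 hk).1 h.symm
      rw [← h, Real.sqrt_zero]
      refine (integral_eq_zero_of_ae ?_).le
      filter_upwards [this] with a ha
      rw [ha]; simp
    · set s := Real.sqrt (∫ a, k a ∂Q) with hsdef
      have hs0 : 0 < s := Real.sqrt_pos.2 h
      have hs2 : s ^ 2 = ∫ a, k a ∂Q := Real.sq_sqrt h.le
      have h1 : ∫ a, Real.sqrt (k a) ∂Q ≤ ∫ a, (k a / (2 * s) + s / 2) ∂Q := by
        refine integral_mono hs ((hk.div_const _).add (integrable_const _)) fun a => ?_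
        have e : k a / (2 * s) + s / 2 - Real.sqrt (k a) = (Real.sqrt (k a) - s) ^ 2 / (2 * s) := by
          field_simp
          rw [sub_sq, Real.sq_sqrt (hk0 a)]; ring
        have : 0 ≤ (Real.sqrt (k a) - s) ^ 2 / (2 * s) := by positivity
        show Real.sqrt (k a) ≤ k a / (2 * s) + s / 2
        linarith
      rw [integral_add (hk.div_const _) (integrable_const _), integral_div, ← hs2] at h1
      simp only [integral_const, probReal_univ, one_smul] at h1
      have e : s ^ 2 / (2 * s) + s / 2 = s := by field_simp; ring
      linarith
  simp_rw [he]
  have hi' : Integrable (fun a => k a - 2 * b * Real.sqrt (k a) + b ^ 2) Q :=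
    hi.add (integrable_const _)
  rw [← ofReal_integral_eq_lintegral_ofReal hi'
    (ae_of_all _ fun a => (sq_nonneg _).trans_eq (he a)),
    integral_add hi (integrable_const _), integral_sub hk (hs.const_mul _), integral_const_mul]
  refine ENNReal.ofReal_le_ofReal ?_
  simp only [integral_const, probReal_univ, one_smul]
  rw [sub_sq, Real.sq_sqrt (integral_nonneg hk0)]
  nlinarith

namespace DensityFamily

variable {p : ℕ} {Θ : Set (EuclideanSpace ℝ (Fin p))}

lemma hellingerDist_density_sq_le_two (M : DensityFamily Θ) (θ θ' : Θ) :
    hellingerDist (M.density θ) (M.density θ') ^ 2 ≤ 2 := by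
  rw [hellingerDist_sq]
  calc _ ≤ ∫⁻ x, (ENNReal.ofReal (M.density θ x) + ENNReal.ofReal (M.density θ' x)) := by
        refine lintegral_mono fun x => ?_
        have h1 := M.density_nonneg θ x
        have h2 := M.density_nonneg θ' x
        rw [← ENNReal.ofReal_add h1 h2]
        refine ENNReal.ofReal_le_ofReal ?_
        rw [sub_sq, Real.sq_sqrt h1, Real.sq_sqrt h2]
        nlinarith [mul_nonneg (Real.sqrt_nonneg (M.density θ x)) (Real.sqrt_nonneg (M.density θ' x))]
    _ = 2 := by
        rw [lintegral_add_left (M.measurable_density_apply θ).ennreal_ofReal,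
          M.lintegral_density, M.lintegral_density, one_add_one_eq_two]

/-- The squared Hellinger distance is convex: a mixture is at most as far as its components are
on average. -/
lemma hellingerDist_integral_density_sq_le (M : DensityFamily Θ) (Q : Measure Θ)
    [IsProbabilityMeasure Q] (θ₀ : Θ) :
    hellingerDist (fun y => ∫ θ, M.density θ y ∂Q) (M.density θ₀) ^ 2 ≤
      ∫⁻ θ, hellingerDist (M.density θ) (M.density θ₀) ^ 2 ∂Q := by
  simp_rw [hellingerDist_sq]
  have hm : Measurable fun q : Θ × ℝ => ENNReal.ofReal
      ((Real.sqrt (M.density q.1 q.2) - Real.sqrt (M.density θ₀ q.2)) ^ 2) :=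
    (((M.measurable_density_comp measurable_fst measurable_snd).sqrt.sub
      (M.measurable_density_comp measurable_const measurable_snd).sqrt).pow_const 2).ennreal_ofReal
  rw [lintegral_lintegral_swap hm.aemeasurable]
  refine lintegral_mono_ae ?_
  filter_upwards [M.ae_integrable_density Q] with y hy
  exact ofReal_sqrt_integral_sub_sq_le Q hy (fun θ => M.density_nonneg θ y) (Real.sqrt_nonneg _)

/-- Split the posterior average of the squared distance: at most `ε ^ 2` on the neighbourhood, at
most 2 off it. -/
lemma hellingerDist_predictiveDensity_sq_le (M : DensityFamily Θ) (prior : Measure Θ) (n : ℕ)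
    (x : ℕ → ℝ) [IsProbabilityMeasure (M.posterior prior n x)] (θ₀ : Θ) (ε : ℝ≥0∞) :
    hellingerDist (M.predictiveDensity prior n x) (M.density θ₀) ^ 2 ≤
      ε ^ 2 + 2 * M.posterior prior n x
        {θ : Θ | hellingerDist (M.density θ) (M.density θ₀) < ε}ᶜ := by
  set V := {θ : Θ | hellingerDist (M.density θ) (M.density θ₀) < ε}
  refine (M.hellingerDist_integral_density_sq_le (M.posterior prior n x) θ₀).trans ?_
  calc _ ≤ ∫⁻ θ, (ε ^ 2 + Vᶜ.indicator (fun _ => 2) θ) ∂(M.posterior prior n x) := by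
        refine lintegral_mono fun θ => ?_
        by_cases h : θ ∈ V
        · refine le_add_right ?_
          have h' : hellingerDist (M.density θ) (M.density θ₀) ≤ ε := le_of_lt h
          gcongr
        · rw [Set.indicator_of_mem h]
          exact le_add_left (M.hellingerDist_density_sq_le_two θ θ₀)
    _ ≤ _ := by
        rw [lintegral_add_left measurable_const, lintegral_const, measure_univ, mul_one]
        gcongr
        exact lintegral_indicator_const_le _ _

lemma predictiveConsistentAt_of_hellingerPosteriorConsistentAt (M : DensityFamily Θ)
    (prior : Measure Θ) (θ₀ : Θ)
    (hprob : ∀ᵐ x ∂(M.sampleLaw θ₀), ∀ n, IsProbabilityMeasure (M.posterior prior n x))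
    (h : M.HellingerPosteriorConsistentAt prior θ₀) : M.PredictiveConsistentAt prior θ₀ := by
  -- The exceptional null set depends on the radius, so countably many radii are fixed to get a
  -- single one.
  have hall := ae_all_iff.2 fun k : ℕ => h (1 / ((k : ℝ) + 1)) Nat.one_div_pos_of_nat
  filter_upwards [hprob, hall] with x hx hc
  have hsq : Tendsto (fun n => hellingerDist (M.predictiveDensity prior n x) (M.density θ₀) ^ 2)
      atTop (𝓝 0) := by
    refine tendsto_order.2 ⟨fun a ha => absurd ha not_lt_zero, fun a ha => ?_⟩
    have h0 : Tendsto (fun k : ℕ => ENNReal.ofReal (1 / ((k : ℝ) + 1)) ^ 2) atTop (𝓝 0) := by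
      have := (ENNReal.continuous_pow 2).tendsto _ |>.comp
        (ENNReal.tendsto_ofReal tendsto_one_div_add_atTop_nhds_zero_nat)
      simpa [Function.comp_def] using this
    obtain ⟨k, hk⟩ := (h0.eventually_lt_const ha).exists
    have h1 := (ENNReal.Tendsto.const_mul (a := 2) (hc k) (.inr ENNReal.ofNat_ne_top)).const_add
      (ENNReal.ofReal (1 / ((k : ℝ) + 1)) ^ 2)
    rw [mul_zero, add_zero] at h1
    filter_upwards [h1.eventually_lt_const hk] with n hn
    have := hx n
    exact (M.hellingerDist_predictiveDensity_sq_le prior n x θ₀ _).trans_lt hn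
  have hr := (ENNReal.continuous_rpow_const (y := 1 / 2)).tendsto 0 |>.comp hsq
  rw [ENNReal.zero_rpow_of_pos (by norm_num)] at hr
  refine hr.congr fun n => ?_
  simp only [Function.comp_apply]
  rw [← ENNReal.rpow_natCast, ← ENNReal.rpow_mul]
  norm_num

end DensityFamily

theorem mainTheorem1 {p : ℕ} (Θ : Set (EuclideanSpace ℝ (Fin p))) (M : DensityFamily Θ)
    (hM : M.EuclideanHellingerEquivalent)
    (prior : Measure Θ) [IsProbabilityMeasure prior] (θ₀ : Θ)
    (hKL : M.InKLSupport prior θ₀) (hid : M.SequentiallyIdentifiableAt θ₀) :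
    M.PosteriorWellDefinedAt prior θ₀ ∧
      M.PosteriorConsistentAt prior θ₀ ∧
      M.HellingerPosteriorConsistentAt prior θ₀ ∧
      M.PredictiveConsistentAt prior θ₀ := by
  have hprob := M.ae_isProbabilityMeasure_posterior prior θ₀ hKL
  have hle := M.posteriorFilter_le_comap_law prior θ₀ hKL
  -- An eventual statement along `posteriorFilter` is by definition almost sure vanishing of the
  -- posterior mass of the complement.
  have hH : M.HellingerPosteriorConsistentAt prior θ₀ := fun ε hε =>
    ((hid.tendsto_hellingerDist hM).mono_left hle).eventually_lt_const (ENNReal.ofReal_pos.2 hε)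
  refine ⟨?_, fun ε hε => (hid.tendsto_norm_sub.mono_left hle).eventually_lt_const hε, hH,
    M.predictiveConsistentAt_of_hellingerPosteriorConsistentAt prior θ₀ hprob hH⟩
  filter_upwards [hprob] with x hx n
  have := hx n
  exact ⟨hx n, M.ae_integrable_density _⟩
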